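/- Let $X$ be a nonempty Tychonoff space, and let $C_p(X)$ be the set of continuous functions $X\to\mathbb R$ with the topology of pointwise convergence. Conventions. For collections $\mathcal A,\mathcal B$ of subsets of a given set, $S_{fin}(\mathcal A,\mathcal B)$ means: for every sequence $(A_n)_{n\in\mathbb N}$ of elements of $\mathcal A$ there are finite sets $B_n\subseteq A_n$ with $\bigcup_n B_n\in\mathcal B$. For a topological space $Z$ and $z\in Z$: - $\mathcal D$ is the family of dense subsets of $Z$; $\mathcal S$ is the family of sequentially dense subsets of $Z$, i.e. of those $A\subseteq Z$ such that every point of $Z$ is the limit of a sequence of points of $A$. $Z$ is sequentially separable if it has a countable sequentially dense subset. - $\Omega_z=\{A\subseteq Z: z\in\overline A\setminus A\}$, and $\Gamma_z$ is the family of infinite sets $A\subseteq Z$ with $z\notin A$ such that $A\setminus U$ is finite for every neighbourhood $U$ of $z$. $S_{fin}(\Gamma_x,\Omega_x)$ and $S_{fin}(\mathcal S,\Omega_x)$, written without specifying $x$, mean that the property holds for every point $x$ of the space. A cover of $X$ is a family $\mathcal U$ of subsets of $X$ with $\bigcup\mathcal U=X$ and $X\notin\mathcal U$. It is an $\omega$-cover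 if every finite subset of $X$ is contained in a member of $\mathcal U$, and a $\gamma$-cover if it is infinite and each $x\in X$ belongs to all but finitely many members of $\mathcal U$. A zero-set of $X$ is a set $f^{-1}(0)$ with $f:X\to\mathbb R$ continuous, and a cozero-set is the complement of a zero-set. $\Omega$ is the family of $\omega$-covers of $X$ by open sets. $\Gamma_F$ is the family of $\gamma$-covers $\mathcal U$ of $X$ by cozero-sets for which there are zero-sets $F(U)\subseteq U$ $(U\in\mathcal U)$ such that $\{F(U):U\in\mathcal U\}$ is a $\gamma$-cover of $X$. $X$ has property $V$ if there is a continuous bijection $f$ of $X$ onto a separable metric space $Y$ such that $f(U)$ is an $F_\sigma$-subset of $Y$ for every cozero-set $U$ of $X$. Theorem. The following are equivalent: 1. $C_p(X)$ is sequentially separable and satisfies $S_{fin}(\mathcal S,\mathcal D)$; 2. $X$ satisfies $S_{fin}(\Gamma_F,\Omega)$ and has property $V$; 3. $C_p(X)$ is sequentially separable and satisfies $S_{fin}(\Gamma_x,\Omega_x)$; 4. $C_p(X)$ is sequentially separable and satisfies $S_{fin}(\mathcal S,\Omega_x)$. -/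

import Mathlib

open Set Filter Topology

universe u

/-- The space `C_p(X)`: the continuous real-valued functions on `X` with the topology of pointwise
convergence (the subspace topology inherited from the product `X → ℝ`). -/
abbrev Cp (X : Type u) [TopologicalSpace X] : Type u := {f : X → ℝ // Continuous f}

/-- The selection principle `S_fin(𝒜, ℬ)` for two collections of subsets of `α`. -/
def SelFin {α : Type u} (𝒜 ℬ : Set (Set α)) : Prop :=
  ∀ A : ℕ → Set α, (∀ n, A n ∈ 𝒜) →
    ∃ B : ℕ → Set α, (∀ n, (B n).Finite ∧ B n ⊆ A n) ∧ (⋃ n, B n) ∈ ℬ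

section Points

variable (X : Type u) [TopologicalSpace X]

/-- `𝒟`: the dense subsets of `X`. -/
def DenseSets : Set (Set X) := {A | Dense A}

/-- `𝒮`: the sequentially dense subsets of `X`, that is, the sets `A` such that every point of `X`
is the limit of a sequence of points of `A`. -/
def SeqDenseSets : Set (Set X) := {A | seqClosure A = univ}

/-- `X` is sequentially separable: it has a countable sequentially dense subset. -/
def SeqSeparable : Prop := ∃ A : Set X, A.Countable ∧ A ∈ SeqDenseSets X

variable {X}

/-- `Ω_x`: the sets `A` with `x ∈ closure A \ A`. -/
def OmegaAt (x : X) : Set (Set X) := {A | x ∈ closure A \ A}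

/-- `Γ_x`: the sets `A` that converge to `x`. -/
def GammaAt (x : X) : Set (Set X) :=
  {A | A.Infinite ∧ x ∉ A ∧ ∀ U ∈ 𝓝 x, (A \ U).Finite}

end Points

section Covers

variable {X : Type u}

/-- A cover of `X` (always nontrivial: `X` itself is not a member). -/
def IsNontrivialCover (𝒰 : Set (Set X)) : Prop := ⋃₀ 𝒰 = univ ∧ univ ∉ 𝒰

/-- A `γ`-cover of `X` by arbitrary sets. -/
def IsGammaCover (𝒰 : Set (Set X)) : Prop :=
  IsNontrivialCover 𝒰 ∧ 𝒰.Infinite ∧ ∀ x : X, {U ∈ 𝒰 | x ∉ U}.Finite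

/-- An `ω`-cover of `X` by arbitrary sets. -/
def IsOmegaCover (𝒰 : Set (Set X)) : Prop :=
  IsNontrivialCover 𝒰 ∧ ∀ K : Set X, K.Finite → ∃ U ∈ 𝒰, K ⊆ U

variable [TopologicalSpace X]

/-- A zero-set: the preimage of `0` under a continuous real-valued function. -/
def IsZeroSet (Z : Set X) : Prop := ∃ f : X → ℝ, Continuous f ∧ Z = f ⁻¹' {0}

/-- A cozero-set: the complement of a zero-set. -/
def IsCozeroSet (U : Set X) : Prop := IsZeroSet Uᶜ

/-- An `F_σ`-set: a countable union of closed sets. -/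
def IsFSigma (A : Set X) : Prop := ∃ C : ℕ → Set X, (∀ n, IsClosed (C n)) ∧ A = ⋃ n, C n

variable (X)

/-- `Ω`: the open `ω`-covers of `X`. -/
def OpenOmegaCovers : Set (Set (Set X)) := {𝒰 | (∀ U ∈ 𝒰, IsOpen U) ∧ IsOmegaCover 𝒰}

/-- `Γ_F`: the `γ_F`-shrinkable `γ`-covers of `X`. -/
def ShrinkableGammaCovers : Set (Set (Set X)) :=
  {𝒰 | (∀ U ∈ 𝒰, IsCozeroSet U) ∧ IsGammaCover 𝒰 ∧
    ∃ F : Set X → Set X, (∀ U ∈ 𝒰, IsZeroSet (F U) ∧ F U ⊆ U) ∧ IsGammaCover (F '' 𝒰)}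

/-- Property `V`: there is a continuous bijection `f` of `X` onto a separable metric space `Y` that
maps every cozero-set of `X` to an `F_σ`-subset of `Y`. -/
def PropertyV : Prop :=
  ∃ (Y : Type u) (_ : MetricSpace Y) (_ : TopologicalSpace.SeparableSpace Y) (f : X → Y),
    Continuous f ∧ Function.Bijective f ∧ ∀ U : Set X, IsCozeroSet U → IsFSigma (f '' U)

end Covers

/-! Sequential separability of `Cp X` is traded for property `V` by Velichko's theorem. A countable
sequentially dense family of functions separates points, hence injects `X` into `ℕ → ℝ`, where
nonvanishing of a pointwise limit along the family is an F_σ condition. Conversely, after embedding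
`Y` in the Hilbert cube, the Lebesgue–Hausdorff theorem makes every continuous function on `X` a
pointwise limit of pullbacks from one countable set (`exists_countable_forall_exists_seq_tendsto`).

The selection principles then go round 4 → 2 → 3 → 4. A set of functions converging to `g` yields
covers by the sets where `|f - g|` is small, shrunk by using a slightly smaller non-strict bound
(`selFin_gammaAt_omegaAt_of_covers`). Small constant translations turn sequentially dense sets into
sets converging to `g` (`selFin_seqDense_omegaAt_of_gammaAt`). A shrinkable cover lets a
sequentially dense sequence be altered off its zero-sets without losing sequential density, so that
closeness to 0 reveals a member of the cover (`selFin_covers_of_seqDense`). Statements 1 and 4 are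
exchanged by treating a countable dense set of points simultaneously, and by deleting a non-isolated
point. -/

/-! ### Functions of the first Baire class. -/

section BaireOne

variable {X Z : Type*} [TopologicalSpace Z]

/-- The characteristic function of a closed set is the eventually constant pointwise limit of
continuous functions. -/
lemma IsClosed.exists_seq_eventually_indicator [TopologicalSpace.MetrizableSpace Z] {C : Set Z}
    (hC : IsClosed C) :
    ∃ θ : ℕ → C(Z, ℝ), (∀ z ∈ C, ∀ m, θ m z = 1) ∧ ∀ z ∉ C, ∀ᶠ m in atTop, θ m z = 0 := by
  let _ := TopologicalSpace.metrizableSpaceMetric Z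
  have hpos : ∀ m : ℕ, (0 : ℝ) < 1 / ((m : ℝ) + 1) := fun m => by positivity
  refine ⟨fun m => ⟨fun z => (thickenedIndicator (hpos m) C z : ℝ), by fun_prop⟩, ?_, ?_⟩
  · intro z hz m
    exact congrArg NNReal.toReal (thickenedIndicator_one (hpos m) C hz)
  · intro z hz
    rw [← hC.closure_eq, Metric.closure_eq_iInter_thickening] at hz
    simp only [mem_iInter, not_forall] at hz
    obtain ⟨δ, hδ, hz⟩ := hz
    filter_upwards [tendsto_one_div_add_atTop_nhds_zero_nat.eventually (gt_mem_nhds hδ)] with m hm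
    exact congrArg NNReal.toReal (thickenedIndicator_zero (hpos m) C
      (fun h => hz (Metric.thickening_mono (le_of_lt hm) C h)))

/-- A function that is constant on the successive differences of a sequence of closed sets is the
eventually constant pointwise limit of continuous functions. -/
lemma exists_seq_eventually_eq_of_closed [TopologicalSpace.MetrizableSpace Z] {C : ℕ → Set Z}
    (hC : ∀ i, IsClosed (C i)) (a : ℕ → ℝ) :
    ∃ u : ℕ → C(Z, ℝ), ∀ z ∈ ⋃ i, C i, ∃ i, z ∈ C i ∧ ∀ᶠ m in atTop, u m z = a i := by
  classical
  choose θ hθ₁ hθ₀ using fun i => (hC i).exists_seq_eventually_indicator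
  -- The weight of `a i` tends to the indicator of `C i` minus all earlier `C l`, so at `z` only the
  -- first `C i` containing it survives.
  refine ⟨fun m => ∑ i ∈ Finset.range (m + 1),
    a i • (θ i m * ∏ l ∈ Finset.range i, (1 - θ l m)), fun z hz => ?_⟩
  have hex : ∃ i, z ∈ C i := by simpa using hz
  refine ⟨Nat.find hex, Nat.find_spec hex, ?_⟩
  have hz₁ := hθ₁ _ z (Nat.find_spec hex)
  have hz₀ : ∀ᶠ m in atTop, ∀ l ∈ Finset.range (Nat.find hex), θ l m z = 0 := by
    rw [Filter.eventually_all_finset]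
    exact fun l hl => hθ₀ l z (Nat.find_min hex (Finset.mem_range.1 hl))
  filter_upwards [hz₀, eventually_ge_atTop (Nat.find hex)] with m hm hge
  simp only [ContinuousMap.coe_sum, Finset.sum_apply, ContinuousMap.coe_smul, Pi.smul_apply,
    ContinuousMap.coe_mul, Pi.mul_apply, ContinuousMap.coe_prod, Finset.prod_apply,
    ContinuousMap.coe_sub, Pi.sub_apply, ContinuousMap.coe_one, Pi.one_apply, smul_eq_mul]
  rw [Finset.sum_eq_single (Nat.find hex)]
  · rw [hz₁, Finset.prod_eq_one]
    · simp
    · intro l hl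
      simp [hm l hl]
  · intro j _ hj
    rcases lt_or_gt_of_ne hj with hj | hj
    · simp [hm j (Finset.mem_range.2 hj)]
    · rw [Finset.prod_eq_zero (Finset.mem_range.2 hj)]
      · simp
      · simp [hz₁]
  · intro h
    exact absurd (Finset.mem_range.2 (Nat.lt_succ_of_le hge)) h

/-- If the preimages of balls under `g` are pulled back from `F_σ`-sets along `e`, then `g` is
uniformly approximated by eventually constant limits of continuous functions. -/
lemma exists_seq_eventually_approx [TopologicalSpace.MetrizableSpace Z] {e : X → Z} {g : X → ℝ}
    (hg : ∀ c r : ℝ, ∃ A : Set Z, IsFSigma A ∧ g ⁻¹' Metric.ball c r = e ⁻¹' A)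
    {ε : ℝ} (hε : 0 < ε) :
    ∃ (u : ℕ → C(Z, ℝ)) (v : X → ℝ), ∀ x, |v x - g x| ≤ ε ∧ ∀ᶠ m in atTop, u m (e x) = v x := by
  -- Balls of radius `ε` about a dense sequence cover the line; their F_σ pullbacks are flattened by
  -- pairing into one sequence of closed sets, each carrying its centre as value.
  choose A hA hgA using fun k : ℕ => hg (TopologicalSpace.denseSeq ℝ k) ε
  choose C hC hAC using hA
  obtain ⟨u, hu⟩ := exists_seq_eventually_eq_of_closed
    (C := fun i => C i.unpair.1 i.unpair.2) (fun i => hC _ _)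
    (fun i => TopologicalSpace.denseSeq ℝ i.unpair.1)
  have key : ∀ x, ∃ v : ℝ, |v - g x| ≤ ε ∧ ∀ᶠ m in atTop, u m (e x) = v := by
    intro x
    obtain ⟨k, hk⟩ := (TopologicalSpace.denseRange_denseSeq ℝ).exists_dist_lt (g x) hε
    have hx : x ∈ e ⁻¹' A k := by rw [← hgA]; exact hk
    rw [hAC, mem_preimage, mem_iUnion] at hx
    obtain ⟨j, hj⟩ := hx
    obtain ⟨i, hi, hev⟩ := hu (e x) (mem_iUnion.2 ⟨Nat.pair k j, by simpa using hj⟩)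
    refine ⟨_, ?_, hev⟩
    have hx' : x ∈ g ⁻¹' Metric.ball (TopologicalSpace.denseSeq ℝ i.unpair.1) ε := by
      rw [hgA, hAC]
      exact mem_iUnion.2 ⟨_, hi⟩
    rw [mem_preimage, Metric.mem_ball, dist_comm, Real.dist_eq] at hx'
    exact hx'.le
  choose v hv using key
  exact ⟨u, v, hv⟩

lemma abs_clamp_le {r : ℝ} (hr : 0 ≤ r) (t : ℝ) : |max (-r) (min r t)| ≤ r :=
  abs_le.2 ⟨le_max_left _ _, max_le (by linarith) (min_le_left _ _)⟩

lemma clamp_eq_self {r t : ℝ} (h : |t| ≤ r) : max (-r) (min r t) = t := by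
  rw [min_eq_right (abs_le.1 h).2, max_eq_right (abs_le.1 h).1]

lemma abs_sum_Ico_le_geometric {w : ℕ → ℝ} (hw : ∀ n, |w n| ≤ 2 * (1 / 2) ^ n) {N m : ℕ}
    (h : N ≤ m) : |∑ n ∈ Finset.Ico N m, w n| ≤ 4 * (1 / 2) ^ N := by
  have : |∑ n ∈ Finset.Ico N m, w n| ≤ 4 * (1 / 2) ^ N - 4 * (1 / 2) ^ m := by
    induction m, h using Nat.le_induction with
    | base => simp
    | succ m hm ih =>
      rw [Finset.sum_Ico_succ_top hm]
      refine (abs_add_le _ _).trans ((add_le_add ih (hw m)).trans (le_of_eq ?_))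
      ring
  have h2 : (0 : ℝ) < (1 / 2) ^ m := by positivity
  linarith

/-- The Lebesgue–Hausdorff theorem: an `F_σ`-measurable real function is of the first Baire
class. -/
lemma exists_seq_tendsto_of_preimage_ball_isFSigma [TopologicalSpace.MetrizableSpace Z] {e : X → Z}
    {g : X → ℝ} (hg : ∀ c r : ℝ, ∃ A : Set Z, IsFSigma A ∧ g ⁻¹' Metric.ball c r = e ⁻¹' A) :
    ∃ h : ℕ → C(Z, ℝ), ∀ x, Tendsto (fun m => h m (e x)) atTop (𝓝 (g x)) := by
  choose u v huv using fun n : ℕ => exists_seq_eventually_approx hg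
    (show (0 : ℝ) < (1 / 2) ^ n by positivity)
  -- Truncation makes the sums over `n` converge uniformly in `m`. It is eventually inactive at each
  -- point, since `v (n + 1)` and `v n` differ by at most `3/2 * (1/2) ^ n`.
  let w : ℕ → ℕ → C(Z, ℝ) := fun n m =>
    ⟨fun z => max (-(2 * (1 / 2) ^ n)) (min (2 * (1 / 2) ^ n) (u (n + 1) m z - u n m z)),
      by fun_prop⟩
  have hw : ∀ n m z, |w n m z| ≤ 2 * (1 / 2) ^ n := fun n m z => abs_clamp_le (by positivity) _
  refine ⟨fun m => u 0 m + ∑ n ∈ Finset.range m, w n m, fun x => ?_⟩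
  rw [Metric.tendsto_atTop']
  intro ε hε
  -- Of the five parts, four bound the tail of the sum and one bounds `|v N x - g x|`.
  obtain ⟨N, hN⟩ := exists_pow_lt_of_lt_one (show (0 : ℝ) < ε / 5 by positivity)
    (show (1 / 2 : ℝ) < 1 by norm_num)
  have hev : ∀ᶠ m in atTop, ∀ n ∈ Finset.range (N + 1), u n m (e x) = v n x := by
    rw [Filter.eventually_all_finset]
    exact fun n _ => (huv n x).2
  obtain ⟨M, hM⟩ := eventually_atTop.1 (hev.and (eventually_ge_atTop N))
  refine ⟨M, fun m hm => ?_⟩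
  obtain ⟨hm₁, hm₂⟩ := hM m hm.le
  have hwv : ∀ n ∈ Finset.range N, w n m (e x) = v (n + 1) x - v n x := by
    intro n hn
    have hn := Finset.mem_range.1 hn
    have h₁ := hm₁ n (Finset.mem_range.2 (by omega))
    have h₂ := hm₁ (n + 1) (Finset.mem_range.2 (by omega))
    change max (-(2 * (1 / 2) ^ n)) (min (2 * (1 / 2) ^ n) (u (n + 1) m (e x) - u n m (e x))) = _
    rw [h₁, h₂, clamp_eq_self]
    have h₃ := abs_le.1 (huv n x).1
    have h₄ := abs_le.1 (huv (n + 1) x).1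
    rw [pow_succ] at h₄
    have h₅ : (0 : ℝ) < (1 / 2) ^ n := by positivity
    rw [abs_le]
    constructor <;> linarith
  have hsum : (u 0 m + ∑ n ∈ Finset.range m, w n m) (e x)
      = v N x + ∑ n ∈ Finset.Ico N m, w n m (e x) := by
    simp only [ContinuousMap.coe_add, Pi.add_apply, ContinuousMap.coe_sum, Finset.sum_apply]
    rw [hm₁ 0 (by simp), ← Finset.sum_range_add_sum_Ico _ hm₂, Finset.sum_congr rfl hwv,
      Finset.sum_range_sub (fun n => v n x)]
    ring
  rw [hsum, Real.dist_eq]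
  have h₁ := abs_le.1 (abs_sum_Ico_le_geometric (fun n => hw n m (e x)) hm₂)
  have h₂ := abs_le.1 (huv N x).1
  rw [abs_lt]
  constructor <;> linarith

/-- A uniform version of the Lebesgue–Hausdorff theorem over a compact metrizable space: all
`F_σ`-measurable functions are limits of sequences from one countable set. -/
lemma exists_countable_forall_exists_seq_tendsto [TopologicalSpace.MetrizableSpace Z]
    [CompactSpace Z] (e : X → Z) :
    ∃ D : Set C(Z, ℝ), D.Countable ∧ ∀ g : X → ℝ,
      (∀ c r : ℝ, ∃ A : Set Z, IsFSigma A ∧ g ⁻¹' Metric.ball c r = e ⁻¹' A) →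
      ∃ h : ℕ → C(Z, ℝ), (∀ m, h m ∈ D) ∧
        ∀ x, Tendsto (fun m => h m (e x)) atTop (𝓝 (g x)) := by
  let _ := TopologicalSpace.metrizableSpaceMetric Z
  -- Compactness of `Z` makes `C(Z, ℝ)` separable in the uniform metric, so `D` is fixed before `g`;
  -- errors of `1 / (m + 1)` do not change pointwise limits.
  obtain ⟨D, hD, hdense⟩ := TopologicalSpace.exists_countable_dense C(Z, ℝ)
  refine ⟨D, hD, fun g hg => ?_⟩
  obtain ⟨h, hh⟩ := exists_seq_tendsto_of_preimage_ball_isFSigma hg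
  choose p hpD hp using fun m : ℕ =>
    hdense.exists_dist_lt (h m) (show (0 : ℝ) < 1 / ((m : ℝ) + 1) by positivity)
  refine ⟨p, hpD, fun x => ?_⟩
  refine (tendsto_iff_of_dist ?_).1 (hh x)
  refine squeeze_zero (fun _ => dist_nonneg) (fun m => ?_)
    tendsto_one_div_add_atTop_nhds_zero_nat
  exact (ContinuousMap.dist_apply_le_dist (e x)).trans (hp m).le

end BaireOne

/-! ### Zero-sets and complete separation. -/

section ZeroSets

variable {X : Type*} [TopologicalSpace X]

lemma isZeroSet_abs_le {h : X → ℝ} (hh : Continuous h) (r : ℝ) : IsZeroSet {x | |h x| ≤ r} := by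
  refine ⟨fun x => max 0 (|h x| - r), by fun_prop, ?_⟩
  ext x
  simp

lemma isCozeroSet_abs_lt {h : X → ℝ} (hh : Continuous h) (r : ℝ) :
    IsCozeroSet {x | |h x| < r} := by
  refine ⟨fun x => max 0 (r - |h x|), by fun_prop, ?_⟩
  ext x
  simp

lemma IsZeroSet.isClosed {Z : Set X} (hZ : IsZeroSet Z) : IsClosed Z := by
  obtain ⟨f, hf, rfl⟩ := hZ
  exact isClosed_singleton.preimage hf

lemma IsCozeroSet.isOpen {U : Set X} (hU : IsCozeroSet U) : IsOpen U :=
  isClosed_compl_iff.1 (IsZeroSet.isClosed hU)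

/-- Disjoint zero-sets are completely separated. -/
lemma IsZeroSet.exists_continuous_separating {Z U : Set X} (hZ : IsZeroSet Z)
    (hU : IsCozeroSet U) (hZU : Z ⊆ U) :
    ∃ φ : X → ℝ, Continuous φ ∧ (∀ x ∈ Z, φ x = 1) ∧ ∀ x ∉ U, φ x = 0 := by
  obtain ⟨a, ha, rfl⟩ := hZ
  obtain ⟨b, hb, hbU⟩ := hU
  have hU' : ∀ x, x ∉ U ↔ b x = 0 := fun x => by
    rw [← mem_compl_iff, hbU]
    simp
  have hpos : ∀ x, |a x| + |b x| ≠ 0 := by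
    intro x hx
    have ha0 : a x = 0 := abs_eq_zero.1 (by linarith [abs_nonneg (a x), abs_nonneg (b x)])
    have hb0 : b x = 0 := abs_eq_zero.1 (by linarith [abs_nonneg (a x), abs_nonneg (b x)])
    exact (hU' x).2 hb0 (hZU ha0)
  refine ⟨fun x => |b x| / (|a x| + |b x|), by fun_prop (disch := exact hpos _), ?_, ?_⟩
  · intro x hx
    have hx : a x = 0 := hx
    have := hpos x
    simp only [hx, abs_zero, zero_add] at this ⊢
    exact div_self this
  · intro x hx
    simp [(hU' x).1 hx]

end ZeroSets

/-! ### Neighbourhoods and closure in `Cp X`. -/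

section PointwiseConvergence

variable {X : Type u} [TopologicalSpace X]

lemma Cp.tendsto_iff {ι : Type*} {l : Filter ι} {F : ι → Cp X} {g : Cp X} :
    Tendsto F l (𝓝 g) ↔ ∀ x, Tendsto (fun i => (F i).1 x) l (𝓝 (g.1 x)) := by
  rw [tendsto_subtype_rng, tendsto_pi_nhds]

lemma Cp.eventually_abs_sub_lt (g : Cp X) {K : Set X} (hK : K.Finite) {ε : ℝ} (hε : 0 < ε) :
    ∀ᶠ f in 𝓝 g, ∀ x ∈ K, |f.1 x - g.1 x| < ε := by
  rw [Filter.eventually_all_finite hK]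
  intro x _
  exact (Cp.tendsto_iff.1 tendsto_id x).eventually (Metric.ball_mem_nhds _ hε)

lemma Cp.mem_closure_iff {A : Set (Cp X)} {g : Cp X} :
    g ∈ closure A ↔
      ∀ K : Set X, K.Finite → ∀ ε : ℝ, 0 < ε → ∃ f ∈ A, ∀ x ∈ K, |f.1 x - g.1 x| < ε := by
  constructor
  · intro h K hK ε hε
    obtain ⟨f, hf, hfA⟩ := mem_closure_iff_nhds.1 h _ (Cp.eventually_abs_sub_lt g hK hε)
    exact ⟨f, hfA, hf⟩
  · intro h
    rw [mem_closure_iff_nhds]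
    intro U hU
    rw [nhds_subtype_eq_comap, mem_comap] at hU
    obtain ⟨V, hV, hVU⟩ := hU
    rw [nhds_pi, Filter.mem_pi] at hV
    obtain ⟨I, hI, t, ht, htV⟩ := hV
    have hev : ∀ᶠ ε : ℝ in 𝓝[>] 0, ∀ x ∈ I, Metric.ball (g.1 x) ε ⊆ t x := by
      rw [Filter.eventually_all_finite hI]
      intro x _
      obtain ⟨δ, hδ, hδt⟩ := Metric.mem_nhds_iff.1 (ht x)
      filter_upwards [Ioo_mem_nhdsGT hδ] with ε hε
      exact (Metric.ball_subset_ball hε.2.le).trans hδt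
    obtain ⟨ε, hεt, hε⟩ := (hev.and self_mem_nhdsWithin).exists
    obtain ⟨f, hfA, hf⟩ := h I hI ε hε
    exact ⟨f, hVU (htV fun x hx => hεt x hx (hf x hx)), hfA⟩

end PointwiseConvergence

/-! ### Velichko's theorem. -/

section SequentialSeparability

lemma SeqSeparable.exists_seq {Z : Type*} [TopologicalSpace Z] [Nonempty Z] (h : SeqSeparable Z) :
    ∃ d : ℕ → Z, ∀ z, ∃ k : ℕ → ℕ, Tendsto k atTop atTop ∧
      Tendsto (fun j => d (k j)) atTop (𝓝 z) := by
  obtain ⟨D, hD, hseq⟩ := h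
  have hseq : ∀ z, z ∈ seqClosure D := fun z => by rw [show seqClosure D = univ from hseq]; trivial
  have hne : D.Nonempty := by
    obtain ⟨x, hx, _⟩ := hseq (Classical.arbitrary Z)
    exact ⟨x 0, hx 0⟩
  obtain ⟨d, rfl⟩ := hD.exists_eq_range hne
  -- Each point is listed infinitely often, so even a constant sequence can be realised along
  -- indices tending to infinity.
  refine ⟨fun m => d m.unpair.1, fun z => ?_⟩
  obtain ⟨x, hx, hlim⟩ := hseq z
  choose i hi using hx
  refine ⟨fun j => Nat.pair (i j) j, tendsto_atTop_mono (fun j => Nat.right_le_pair _ _) tendsto_id,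
    ?_⟩
  simpa [hi] using hlim

variable {X : Type u} [TopologicalSpace X]

/-- One half of Velichko's theorem. -/
theorem PropertyV.seqSeparable (h : PropertyV X) : SeqSeparable (Cp X) := by
  obtain ⟨Y, _, _, f, hf, hbij, hU⟩ := h
  obtain ⟨F, hF⟩ := Metric.PiNatEmbed.exists_embedding_to_hilbert_cube (X := Y)
  obtain ⟨D, hD, hlim⟩ := exists_countable_forall_exists_seq_tendsto (fun x => F (f x))
  have hcont : Continuous fun x => F (f x) := hF.continuous.comp hf
  refine ⟨(fun h : C(ℕ → unitInterval, ℝ) => (⟨fun x => h (F (f x)), by fun_prop⟩ : Cp X)) '' D,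
    hD.image _, eq_univ_of_forall fun g => ?_⟩
  obtain ⟨h, hhD, hh⟩ := hlim g.1 fun c r => by
    have hg := g.2
    obtain ⟨C, hC, hCU⟩ := hU _ (isCozeroSet_abs_lt (h := fun x => g.1 x - c) (by fun_prop) r)
    choose T hT hTC using fun n => hF.isInducing.isClosed_iff.1 (hC n)
    refine ⟨⋃ n, T n, ⟨T, hT, rfl⟩, ?_⟩
    have : g.1 ⁻¹' Metric.ball c r = f ⁻¹' ⋃ n, C n := by
      rw [← hCU, hbij.1.preimage_image]
      rfl
    rw [this]
    ext x
    simp [← hTC]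
  exact ⟨_, fun m => ⟨h m, hhD m, rfl⟩, Cp.tendsto_iff.2 hh⟩

/-- The other half of Velichko's theorem. -/
theorem SeqSeparable.propertyV [T35Space X] (h : SeqSeparable (Cp X)) : PropertyV X := by
  have : Nonempty (Cp X) := ⟨⟨fun _ => 0, continuous_const⟩⟩
  obtain ⟨d, hd⟩ := h.exists_seq
  let e : X → ℕ → ℝ := fun x k => (d k).1 x
  have he : Continuous e := continuous_pi fun k => (d k).2
  have hinj : Function.Injective e := by
    intro x y hxy
    by_contra hne
    obtain ⟨φ, hφ, hφx, hφy⟩ := CompletelyRegularSpace.completely_regular x {y}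
      isClosed_singleton hne
    obtain ⟨k, _, hk⟩ := hd ⟨fun z => (φ z : ℝ), by fun_prop⟩
    rw [Cp.tendsto_iff] at hk
    have hy := hk y
    have hxy' : (fun j => (d (k j)).1 y) = fun j => (d (k j)).1 x :=
      funext fun j => (congrFun hxy (k j)).symm
    rw [hxy'] at hy
    have := tendsto_nhds_unique (hk x) hy
    simp [hφx, hφy (mem_singleton y)] at this
  let _ : MetricSpace (ℕ → ℝ) := TopologicalSpace.metrizableSpaceMetric (ℕ → ℝ)
  -- `range e` lives in the lowest universe, whereas `Y` must share the universe of `X`.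
  refine ⟨ULift.{u} (range e), inferInstance,
    Homeomorph.ulift.symm.surjective.denseRange.separableSpace Homeomorph.ulift.symm.continuous,
    fun x => ⟨⟨e x, x, rfl⟩⟩,
    by fun_prop, ⟨fun x y hxy => ?_, ?_⟩, fun U hU => ?_⟩
  · exact hinj (congrArg (fun z => z.down.1) hxy)
  · rintro ⟨⟨_, x, rfl⟩⟩
    exact ⟨x, rfl⟩
  · obtain ⟨g, hg, hgU⟩ := hU
    have hmem : ∀ x, x ∈ U ↔ g x ≠ 0 := fun x => by
      rw [← not_iff_not, ← mem_compl_iff, hgU]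
      simp
    obtain ⟨k, _, hk⟩ := hd ⟨g, hg⟩
    rw [Cp.tendsto_iff] at hk
    -- The limit is nonzero exactly when the coordinates `k j` eventually stay at distance at least
    -- some `1 / (m + 1)` from 0; `i` encodes the pair of starting index and `m`.
    refine ⟨fun i => {y | ∀ j ≥ i.unpair.1, 1 / ((i.unpair.2 : ℝ) + 1) ≤ |y.down.1 (k j)|},
      fun i => ?_, ?_⟩
    · simp only [ofPred_forall]
      refine isClosed_iInter fun j => isClosed_iInter fun _ => isClosed_le continuous_const ?_
      exact ((continuous_apply (k j)).comp
        (continuous_subtype_val.comp continuous_uliftDown)).abs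
    · ext ⟨⟨_, x, rfl⟩⟩
      have himg : (⟨⟨e x, x, rfl⟩⟩ : ULift.{u} (range e)) ∈
          (fun x => (⟨⟨e x, x, rfl⟩⟩ : ULift.{u} (range e))) '' U ↔ g x ≠ 0 := by
        rw [← hmem]
        constructor
        · rintro ⟨z, hz, hzx⟩
          rwa [← hinj (congrArg (fun z => z.down.1) hzx)]
        · exact fun hx => ⟨x, hx, rfl⟩
      rw [himg, mem_iUnion]
      constructor
      · intro hx
        obtain ⟨m, hm⟩ := exists_nat_one_div_lt (abs_pos.2 hx)
        obtain ⟨N, hN⟩ := eventually_atTop.1 ((hk x).abs.eventually (lt_mem_nhds hm))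
        refine ⟨Nat.pair N m, fun j hj => ?_⟩
        rw [Nat.unpair_pair] at hj ⊢
        exact (hN j hj).le
      · rintro ⟨i, hi⟩ hx
        have hpos : (0 : ℝ) < 1 / ((i.unpair.2 : ℝ) + 1) := by positivity
        have hlim := (hk x).abs
        rw [show (⟨g, hg⟩ : Cp X).1 x = 0 from hx, abs_zero] at hlim
        obtain ⟨j, hj₁, hj₂⟩ :=
          ((hlim.eventually (gt_mem_nhds hpos)).and (eventually_ge_atTop i.unpair.1)).exists
        exact absurd (hi j hj₂) (not_le.2 hj₁)

end SequentialSeparability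

/-! ### Combinatorics of γ-covers and ω-covers. -/

section GammaCovers

variable {X : Type u}

/-- Each member omits a point, which only finitely many indices omit; so the fibres of `U` are
finite and an infinite index set has infinite image. -/
lemma isGammaCover_image {ι : Type*} {A : Set ι} (hA : A.Infinite) {U : ι → Set X}
    (hU : ∀ i ∈ A, U i ≠ univ) (hfin : ∀ x, {i ∈ A | x ∉ U i}.Finite) :
    IsGammaCover (U '' A) := by
  refine ⟨⟨eq_univ_of_forall fun x => ?_, ?_⟩, fun him => ?_, fun x => ?_⟩
  · by_contra hx
    exact hA ((hfin x).subset fun i hi => ⟨hi, fun hxi => hx ⟨U i, ⟨i, hi, rfl⟩, hxi⟩⟩)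
  · rintro ⟨i, hi, hiU⟩
    exact hU i hi hiU
  · refine hA ((him.biUnion (t := fun V => {i ∈ A | U i = V}) ?_).subset
      fun i hi => mem_biUnion (mem_image_of_mem U hi) ⟨hi, rfl⟩)
    rintro _ ⟨i, hi, rfl⟩
    obtain ⟨x, hx⟩ := (ne_univ_iff_exists_notMem _).1 (hU i hi)
    exact (hfin x).subset fun j hj => ⟨hj.1, by rwa [hj.2]⟩
  · refine ((hfin x).image U).subset ?_
    rintro _ ⟨⟨i, hi, rfl⟩, hx⟩
    exact ⟨i, ⟨hi, hx⟩, rfl⟩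

lemma IsOmegaCover.exists_ge [Nonempty X] {𝒱 : ℕ → Set (Set X)} (h : IsOmegaCover (⋃ n, 𝒱 n))
    (hfin : ∀ n, (𝒱 n).Finite) {K : Set X} (hK : K.Finite) (N : ℕ) :
    ∃ n ≥ N, ∃ V ∈ 𝒱 n, K ⊆ V := by
  have hne : ∀ V ∈ ⋃ n, 𝒱 n, ∃ x, x ∉ V := fun V hV =>
    (ne_univ_iff_exists_notMem _).1 fun hV' => h.1.2 (hV' ▸ hV)
  choose! p hp using hne
  have hW : (⋃ n ∈ Finset.range N, 𝒱 n).Finite :=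
    (Finset.range N).finite_toSet.biUnion fun n _ => hfin n
  -- Adjoining to `K` a point missed by each of the finitely many early members rules all of them
  -- out.
  obtain ⟨V, hV, hKV⟩ := h.2 _ (hK.union (hW.image p))
  obtain ⟨n, hn⟩ := mem_iUnion.1 hV
  refine ⟨n, ?_, V, hn, subset_union_left.trans hKV⟩
  by_contra hlt
  refine hp V hV (hKV (Or.inr ⟨V, ?_, rfl⟩))
  exact mem_biUnion (Finset.mem_coe.2 (Finset.mem_range.2 (not_le.1 hlt))) hn

variable [TopologicalSpace X]

lemma image_mem_shrinkableGammaCovers {ι : Type*} {A : Set ι} (hA : A.Infinite)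
    {U Z : ι → Set X} (hU : ∀ i ∈ A, U i ≠ univ) (hco : ∀ i ∈ A, IsCozeroSet (U i))
    (hZ : ∀ i ∈ A, IsZeroSet (Z i)) (hZU : ∀ i ∈ A, Z i ⊆ U i)
    (hfin : ∀ x, {i ∈ A | x ∉ Z i}.Finite) : U '' A ∈ ShrinkableGammaCovers X := by
  have hγ : IsGammaCover (U '' A) := isGammaCover_image hA hU fun x =>
    (hfin x).subset fun i hi => ⟨hi.1, fun hx => hi.2 (hZU i hi.1 hx)⟩
  have : Nonempty ι := hA.nonempty.to_subtype.map Subtype.val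
  have hex : ∀ V ∈ U '' A, ∃ i, i ∈ A ∧ U i = V := fun V hV => hV
  -- A shrinking depends on the set and not on its index, so one index is fixed for each member.
  choose! s hsA hsU using hex
  refine ⟨?_, hγ, fun V => Z (s V), fun V hV => ⟨hZ _ (hsA V hV), ?_⟩, ?_⟩
  · rintro _ ⟨i, hi, rfl⟩
    exact hco i hi
  · exact (hZU _ (hsA V hV)).trans (hsU V hV).subset
  · refine isGammaCover_image hγ.2.1 (fun V hV hV' => hU _ (hsA V hV) ?_) fun x => ?_
    · exact univ_subset_iff.1 (hV' ▸ hZU _ (hsA V hV))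
    · refine ((hfin x).image U).subset fun V hV => ⟨s V, ⟨hsA V hV.1, hV.2⟩, hsU V hV.1⟩

lemma exists_seq_of_mem_shrinkableGammaCovers {𝒰 : Set (Set X)}
    (h : 𝒰 ∈ ShrinkableGammaCovers X) :
    ∃ U Z : ℕ → Set X, (∀ m, U m ∈ 𝒰 ∧ IsCozeroSet (U m) ∧ IsZeroSet (Z m) ∧ Z m ⊆ U m) ∧
      ∀ x, ∀ᶠ m in atTop, x ∈ Z m := by
  obtain ⟨hco, -, F, hF, hγ⟩ := h
  let Z := hγ.2.1.natEmbedding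
  choose U hU hUZ using fun m => (Z m).2
  refine ⟨U, fun m => Z m, fun m => ⟨hU m, hco _ (hU m), ?_⟩, fun x => ?_⟩
  · change IsZeroSet (Z m : Set X) ∧ (Z m : Set X) ⊆ U m
    rw [← hUZ]
    exact hF _ (hU m)
  · rw [← Nat.cofinite_eq_atTop, Filter.eventually_cofinite]
    exact ((hγ.2.2 x).preimage (Subtype.val_injective.comp Z.injective).injOn).subset
      fun m hm => ⟨(Z m).2, hm⟩

end GammaCovers

/-! ### Transfer of selection principles. -/

section SelectionPrinciples

lemma exists_finite_subset_dominating {ι X : Type*} [Nonempty ι] {A : Set ι} {U : ι → Set X}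
    {𝒱 : Set (Set X)} (hfin : 𝒱.Finite) (h : 𝒱 ⊆ U '' A) :
    ∃ B : Set ι, B.Finite ∧ B ⊆ A ∧ ∀ V ∈ 𝒱, ∃ i ∈ B, V ⊆ U i := by
  have hex : ∀ V ∈ 𝒱, ∃ i, i ∈ A ∧ U i = V := fun V hV => h hV
  choose! s hsA hsU using hex
  refine ⟨s '' 𝒱, hfin.image s, image_subset_iff.2 hsA, fun V hV => ⟨s V, ⟨V, hV, rfl⟩, ?_⟩⟩
  exact (hsU V hV).symm.subset

lemma range_mem_gammaAt {Z : Type*} [TopologicalSpace Z] [T1Space Z] {a : ℕ → Z} {z : Z}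
    (ha : Tendsto a atTop (𝓝 z)) (hne : ∀ j, a j ≠ z) : range a ∈ GammaAt z := by
  have hz : z ∉ range a := by
    rintro ⟨j, hj⟩
    exact hne j hj
  refine ⟨fun hfin => hz ?_, hz, fun U hU => ?_⟩
  · rw [← hfin.isClosed.closure_eq]
    exact mem_closure_of_tendsto ha (Eventually.of_forall mem_range_self)
  · have hev := ha.eventually hU
    rw [← Nat.cofinite_eq_atTop, Filter.eventually_cofinite] at hev
    refine (hev.image a).subset ?_
    rintro _ ⟨⟨j, rfl⟩, hj⟩
    exact ⟨j, hj, rfl⟩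

variable {X : Type u} [TopologicalSpace X]

lemma GammaAt.finite_le_abs_sub {g : Cp X} {A : Set (Cp X)} (hA : A ∈ GammaAt g) (x : X) {ε : ℝ}
    (hε : 0 < ε) : {f ∈ A | ε ≤ |f.1 x - g.1 x|}.Finite := by
  refine (hA.2.2 _ (Cp.eventually_abs_sub_lt g (finite_singleton x) hε)).subset ?_
  rintro f ⟨hf, hfx⟩
  exact ⟨hf, fun h => absurd (h x rfl) (not_lt.2 hfx)⟩

/-- The first `N` finite sets have a closed union missing `g`, so its complement can be intersected
with any neighbourhood of `g`. -/
lemma Cp.exists_ge_of_mem_closure_iUnion {B : ℕ → Set (Cp X)} {g : Cp X}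
    (hB : (⋃ n, B n) ∈ OmegaAt g) (hfin : ∀ n, (B n).Finite) {K : Set X} (hK : K.Finite) {ε : ℝ}
    (hε : 0 < ε) (N : ℕ) : ∃ n ≥ N, ∃ f ∈ B n, ∀ x ∈ K, |f.1 x - g.1 x| < ε := by
  have hW : (⋃ n ∈ Finset.range N, B n).Finite :=
    (Finset.range N).finite_toSet.biUnion fun n _ => hfin n
  have hgW : g ∉ ⋃ n ∈ Finset.range N, B n := fun h => hB.2 (by
    obtain ⟨n, _, hn⟩ := mem_iUnion₂.1 h
    exact mem_iUnion.2 ⟨n, hn⟩)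
  obtain ⟨f, ⟨hf, hfW⟩, hfB⟩ := mem_closure_iff_nhds.1 hB.1 _
    (inter_mem (Cp.eventually_abs_sub_lt g hK hε) (hW.isClosed.isOpen_compl.mem_nhds hgW))
  obtain ⟨n, hn⟩ := mem_iUnion.1 hfB
  refine ⟨n, ?_, f, hn, hf⟩
  by_contra hlt
  exact hfW (mem_iUnion₂.2 ⟨n, Finset.mem_range.2 (not_le.1 hlt), hn⟩)

/-- The translate of a continuous function by a constant. -/
def Cp.addConst (f : Cp X) (c : ℝ) : Cp X := ⟨fun x => f.1 x + c, f.2.add continuous_const⟩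

lemma Cp.addConst_addConst_neg (f : Cp X) (c : ℝ) : (f.addConst (-c)).addConst c = f :=
  Subtype.ext (funext fun x => neg_add_cancel_right (f.1 x) c)

lemma Cp.addConst_neg_addConst (f : Cp X) (c : ℝ) : (f.addConst c).addConst (-c) = f :=
  Subtype.ext (funext fun x => add_neg_cancel_right (f.1 x) c)

lemma Cp.addConst_ne [Nonempty X] (f : Cp X) {c : ℝ} (hc : c ≠ 0) : f.addConst c ≠ f := by
  intro h
  obtain ⟨x⟩ := ‹Nonempty X›
  have : f.1 x + c = f.1 x := congrFun (congrArg Subtype.val h) x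
  exact hc (by linarith)

lemma Cp.continuous_addConst (c : ℝ) : Continuous fun f : Cp X => f.addConst c :=
  Continuous.subtype_mk (continuous_pi fun x =>
    ((continuous_apply x).comp continuous_subtype_val).add continuous_const) _

lemma Cp.tendsto_addConst_one_div (g : Cp X) :
    Tendsto (fun j : ℕ => g.addConst (1 / ((j : ℝ) + 1))) atTop (𝓝 g) := by
  refine Cp.tendsto_iff.2 fun x => ?_
  have := (tendsto_one_div_add_atTop_nhds_zero_nat (𝕜 := ℝ)).const_add (g.1 x)
  rwa [add_zero] at this

lemma Cp.nhdsNE_neBot [Nonempty X] (g : Cp X) : (𝓝[≠] g).NeBot :=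
  mem_closure_iff_nhdsWithin_neBot.1 <| mem_closure_of_tendsto (Cp.tendsto_addConst_one_div g) <|
    Eventually.of_forall fun _ => Cp.addConst_ne g (by positivity)

theorem selFin_gammaAt_omegaAt_of_covers [Nonempty X]
    (h : SelFin (ShrinkableGammaCovers X) (OpenOmegaCovers X)) (g : Cp X) :
    SelFin (GammaAt g) (OmegaAt g) := by
  classical
  intro A hA
  have : Nonempty (Cp X) := ⟨g⟩
  let U : ℕ → Cp X → Set X := fun n f => {x | |f.1 x - g.1 x| < 1 / ((n : ℝ) + 1)}
  have hcov : ∀ n, (∀ f ∈ A n, U n f ≠ univ) → U n '' A n ∈ ShrinkableGammaCovers X := by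
    intro n hn
    have hlt : 1 / ((n : ℝ) + 2) < 1 / ((n : ℝ) + 1) :=
      one_div_lt_one_div_of_lt (by positivity) (by linarith)
    refine image_mem_shrinkableGammaCovers
      (Z := fun f => {x | |f.1 x - g.1 x| ≤ 1 / ((n : ℝ) + 2)}) (hA n).1 hn
      (fun f _ => isCozeroSet_abs_lt (f.2.sub g.2) _) (fun f _ => isZeroSet_abs_le (f.2.sub g.2) _)
      (fun f _ x hx => lt_of_le_of_lt hx hlt) fun x => ?_
    refine (GammaAt.finite_le_abs_sub (hA n) x
      (show (0 : ℝ) < 1 / ((n : ℝ) + 2) by positivity)).subset fun f hf => ⟨hf.1, ?_⟩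
    exact (not_le.1 hf.2).le
  suffices hB : ∃ B : ℕ → Set (Cp X), (∀ n, (B n).Finite ∧ B n ⊆ A n) ∧
      ∀ K : Set X, K.Finite → ∀ N, ∃ n ≥ N, ∃ f ∈ B n, K ⊆ U n f by
    obtain ⟨B, hBA, hB⟩ := hB
    refine ⟨B, hBA, Cp.mem_closure_iff.2 fun K hK ε hε => ?_, fun hg => ?_⟩
    · obtain ⟨N, hN⟩ := exists_nat_one_div_lt hε
      obtain ⟨n, hn, f, hf, hKf⟩ := hB K hK N
      exact ⟨f, mem_iUnion.2 ⟨n, hf⟩, fun x hx =>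
        (hKf hx).trans_le ((Nat.one_div_le_one_div hn).trans hN.le)⟩
    · obtain ⟨n, hn⟩ := mem_iUnion.1 hg
      exact (hA n).2.1 ((hBA n).2 hn)
  -- If some `f ∈ A n` has `U n f = univ`, the family is no cover, but `f` alone is uniformly close
  -- to `g`. Such stages borrow the cover of a good stage `n₀`; if no stage is good, these `f`
  -- suffice.
  by_cases hall : ∃ n₀, ∀ f ∈ A n₀, U n₀ f ≠ univ
  · obtain ⟨n₀, hn₀⟩ := hall
    obtain ⟨𝒱, h𝒱, -, h𝒱ω⟩ := h
      (fun n => if ∀ f ∈ A n, U n f ≠ univ then U n '' A n else U n₀ '' A n₀) (fun n => by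
        split_ifs with hn
        exacts [hcov n hn, hcov n₀ hn₀])
    have hex : ∀ n, ∃ B : Set (Cp X), B.Finite ∧ B ⊆ A n ∧ ∀ V ∈ 𝒱 n, ∃ f ∈ B, V ⊆ U n f := by
      intro n
      by_cases hn : ∀ f ∈ A n, U n f ≠ univ
      · have := (h𝒱 n).2
        rw [if_pos hn] at this
        exact exists_finite_subset_dominating (h𝒱 n).1 this
      · push Not at hn
        obtain ⟨f, hf, hfU⟩ := hn
        exact ⟨{f}, finite_singleton f, singleton_subset_iff.2 hf,
          fun V _ => ⟨f, rfl, hfU ▸ subset_univ V⟩⟩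
    choose B hBfin hBA hBV using hex
    refine ⟨B, fun n => ⟨hBfin n, hBA n⟩, fun K hK N => ?_⟩
    obtain ⟨n, hn, V, hV, hKV⟩ := h𝒱ω.exists_ge (fun n => (h𝒱 n).1) hK N
    obtain ⟨f, hf, hVf⟩ := hBV n V hV
    exact ⟨n, hn, f, hf, hKV.trans hVf⟩
  · push Not at hall
    choose b hb hbU using hall
    exact ⟨fun n => {b n}, fun n => ⟨finite_singleton _, singleton_subset_iff.2 (hb n)⟩,
      fun K _ N => ⟨N, le_rfl, b N, rfl, hbU N ▸ subset_univ K⟩⟩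

theorem selFin_seqDense_omegaAt_of_gammaAt [Nonempty X] {g : Cp X}
    (h : SelFin (GammaAt g) (OmegaAt g)) : SelFin (SeqDenseSets (Cp X)) (OmegaAt g) := by
  classical
  intro A hA
  let c : ℕ → ℝ := fun n => 1 / ((n : ℝ) + 1)
  have hc : ∀ n, 0 < c n := fun n => by positivity
  have hex : ∀ n, ∃ T ∈ GammaAt g, g.addConst (c n) ∈ A n ∨
      ∀ t ∈ T, t.addConst (c n) ∈ A n ∧ t.addConst (c n) ≠ g := by
    intro n
    by_cases hn : g.addConst (c n) ∈ A n
    · exact ⟨_, range_mem_gammaAt (Cp.tendsto_addConst_one_div g)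
        (fun j => Cp.addConst_ne g (hc j).ne'), Or.inl hn⟩
    · have hmem : g.addConst (c n) ∈ seqClosure (A n) := by
        rw [show seqClosure (A n) = univ from hA n]
        trivial
      obtain ⟨a, haA, ha⟩ := hmem
      obtain ⟨J, hJ⟩ := eventually_atTop.1
        (ha.eventually (isOpen_compl_singleton.mem_nhds (Cp.addConst_ne g (hc n).ne')))
      have hlim : Tendsto (fun j => (a (j + J)).addConst (-c n)) atTop (𝓝 g) := by
        have := ((Cp.continuous_addConst (-c n)).tendsto _).comp
          (ha.comp (tendsto_add_atTop_nat J))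
        rwa [Cp.addConst_neg_addConst] at this
      refine ⟨_, range_mem_gammaAt hlim fun j hj => hn ?_, Or.inr ?_⟩
      · rw [← hj, Cp.addConst_addConst_neg]
        exact haA _
      · rintro _ ⟨j, rfl⟩
        rw [Cp.addConst_addConst_neg]
        exact ⟨haA _, hJ _ (Nat.le_add_left _ _)⟩
  choose T hT hTA using hex
  obtain ⟨B, hB, hBω⟩ := h T hT
  refine ⟨fun n => if g.addConst (c n) ∈ A n then {g.addConst (c n)}
    else (fun f => Cp.addConst f (c n)) '' B n, fun n => ?_, Cp.mem_closure_iff.2 ?_, fun hg => ?_⟩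
  · dsimp only
    split_ifs with hn
    · exact ⟨finite_singleton _, singleton_subset_iff.2 hn⟩
    · refine ⟨(hB n).1.image _, ?_⟩
      rintro _ ⟨t, ht, rfl⟩
      exact (((hTA n).resolve_left hn) t ((hB n).2 ht)).1
  · intro K hK ε hε
    obtain ⟨N, hN⟩ := exists_nat_one_div_lt (half_pos hε)
    obtain ⟨n, hn, t, ht, htK⟩ :=
      Cp.exists_ge_of_mem_closure_iUnion hBω (fun n => (hB n).1) hK (half_pos hε) N
    have hcn : c n < ε / 2 := (Nat.one_div_le_one_div hn).trans_lt hN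
    by_cases hnA : g.addConst (c n) ∈ A n
    · refine ⟨g.addConst (c n), mem_iUnion.2 ⟨n, by simp [hnA]⟩, fun x _ => ?_⟩
      change |g.1 x + c n - g.1 x| < ε
      rw [add_sub_cancel_left, abs_of_pos (hc n)]
      linarith
    · refine ⟨t.addConst (c n), mem_iUnion.2 ⟨n, ?_⟩, fun x hx => ?_⟩
      · rw [if_neg hnA]
        exact ⟨t, ht, rfl⟩
      · change |t.1 x + c n - g.1 x| < ε
        have h₁ := abs_lt.1 (htK x hx)
        have h₂ := hc n
        rw [abs_lt]
        constructor <;> linarith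
  · obtain ⟨n, hn⟩ := mem_iUnion.1 hg
    split_ifs at hn with hnA
    · exact Cp.addConst_ne g (hc n).ne' (mem_singleton_iff.1 hn).symm
    · obtain ⟨t, ht, htg⟩ := hn
      exact (((hTA n).resolve_left hnA) t ((hB n).2 ht)).2 htg

/-- Split the sequence of sets into infinitely many subsequences by pairing, and let the `k`-th one
accumulate at the `k`-th point of a countable dense set. -/
theorem selFin_seqDense_dense_of_omegaAt {Z : Type*} [TopologicalSpace Z] [Nonempty Z]
    (hsep : SeqSeparable Z) (h : ∀ z : Z, SelFin (SeqDenseSets Z) (OmegaAt z)) :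
    SelFin (SeqDenseSets Z) (DenseSets Z) := by
  intro A hA
  obtain ⟨d, hd⟩ := hsep.exists_seq
  have hdense : Dense (range d) := fun z => by
    obtain ⟨k, _, hk⟩ := hd z
    exact mem_closure_of_tendsto hk (Eventually.of_forall fun j => mem_range_self _)
  choose B hB hBω using fun k => h (d k) (fun n => A (Nat.pair k n)) fun n => hA _
  refine ⟨fun m => B m.unpair.1 m.unpair.2, fun m => ?_, ?_⟩
  · have := hB m.unpair.1 m.unpair.2
    rwa [Nat.pair_unpair] at this
  · refine Dense.of_closure (hdense.mono ?_)
    rintro _ ⟨k, rfl⟩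
    refine closure_mono (iUnion_subset fun n => ?_) (hBω k).1
    refine subset_iUnion_of_subset (Nat.pair k n) ?_
    rw [Nat.unpair_pair]

theorem selFin_omegaAt_of_selFin_dense {Z : Type*} [TopologicalSpace Z] [T1Space Z]
    {𝒜 : Set (Set Z)} {z : Z} [(𝓝[≠] z).NeBot] (h : SelFin 𝒜 (DenseSets Z)) :
    SelFin 𝒜 (OmegaAt z) := by
  intro A hA
  obtain ⟨B, hB, hdense⟩ := h A hA
  refine ⟨fun n => B n \ {z}, fun n => ⟨(hB n).1.subset sdiff_subset, sdiff_subset.trans (hB n).2⟩,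
    ?_, ?_⟩
  · rw [← iUnion_sdiff]
    exact Dense.sdiff_singleton hdense z z
  · simp

theorem selFin_covers_of_seqDense (hsep : SeqSeparable (Cp X))
    (h : ∀ g : Cp X, SelFin (SeqDenseSets (Cp X)) (OmegaAt g)) :
    SelFin (ShrinkableGammaCovers X) (OpenOmegaCovers X) := by
  intro 𝒰 h𝒰
  let g₀ : Cp X := ⟨fun _ => 0, continuous_const⟩
  have : Nonempty (Cp X) := ⟨g₀⟩
  obtain ⟨d, hd⟩ := hsep.exists_seq
  choose U Z hUZ hZ using fun n => exists_seq_of_mem_shrinkableGammaCovers (h𝒰 n)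
  choose φ hφ hφ₁ hφ₀ using fun n m =>
    (hUZ n m).2.2.1.exists_continuous_separating (hUZ n m).2.1 (hUZ n m).2.2.2
  -- `f n m` equals `d m` on `Z n m` and 1 off `U n m`. Every point lies in almost all `Z n m`, so
  -- limits are unaffected, while being within 1 of zero on `K` forces `K ⊆ U n m`.
  let f : ℕ → ℕ → Cp X := fun n m =>
    ⟨fun x => (d m).1 x * φ n m x + (1 - φ n m x),
      ((d m).2.mul (hφ n m)).add (continuous_const.sub (hφ n m))⟩
  obtain ⟨B, hB, hBω⟩ := h g₀ (fun n => range (f n)) fun n => by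
    refine eq_univ_of_forall fun g => ?_
    obtain ⟨k, hk, hlim⟩ := hd g
    refine ⟨fun j => f n (k j), fun j => mem_range_self _, Cp.tendsto_iff.2 fun x => ?_⟩
    refine (Cp.tendsto_iff.1 hlim x).congr' ?_
    filter_upwards [hk.eventually (hZ n x)] with j hj
    change _ = (d (k j)).1 x * φ n (k j) x + (1 - φ n (k j) x)
    rw [hφ₁ n (k j) x hj]
    ring
  choose s hs using fun n => fun b : B n => (hB n).2 b.2
  have hmem : ∀ n, ∀ b : B n, U n (s n b) ∈ 𝒰 n := fun n b => (hUZ n _).1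
  have hω : ∀ K : Set X, K.Finite → ∃ V ∈ ⋃ n, range fun b : B n => U n (s n b), K ⊆ V := by
    intro K hK
    obtain ⟨b, hb, hbK⟩ := Cp.mem_closure_iff.1 hBω.1 K hK 1 one_pos
    obtain ⟨n, hn⟩ := mem_iUnion.1 hb
    refine ⟨_, mem_iUnion.2 ⟨n, mem_range_self ⟨b, hn⟩⟩, fun x hx => ?_⟩
    by_contra hxU
    have hbx := hbK x hx
    rw [show b = f n (s n ⟨b, hn⟩) from (hs n ⟨b, hn⟩).symm] at hbx
    change |(d (s n ⟨b, hn⟩)).1 x * φ n (s n ⟨b, hn⟩) x + (1 - φ n (s n ⟨b, hn⟩) x) - 0| < 1 at hbx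
    rw [hφ₀ n _ x hxU] at hbx
    norm_num at hbx
  refine ⟨fun n => range fun b : B n => U n (s n b), fun n => ⟨?_, ?_⟩, ?_, ⟨?_, ?_⟩, hω⟩
  · have := (hB n).1.to_subtype
    exact finite_range _
  · rintro _ ⟨b, rfl⟩
    exact hmem n b
  · intro V hV
    obtain ⟨n, b, rfl⟩ := mem_iUnion.1 hV
    exact (hUZ n _).2.1.isOpen
  · refine eq_univ_of_forall fun x => ?_
    obtain ⟨V, hV, hxV⟩ := hω {x} (finite_singleton x)
    exact ⟨V, hV, hxV rfl⟩
  · intro hV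
    obtain ⟨n, b, hb⟩ := mem_iUnion.1 hV
    exact (h𝒰 n).2.1.1.2 (hb ▸ hmem n b)

end SelectionPrinciples

theorem mainTheorem5 (X : Type u) [TopologicalSpace X] [T35Space X] [Nonempty X] :
    List.TFAE [
      SeqSeparable (Cp X) ∧ SelFin (SeqDenseSets (Cp X)) (DenseSets (Cp X)),
      SelFin (ShrinkableGammaCovers X) (OpenOmegaCovers X) ∧ PropertyV X,
      SeqSeparable (Cp X) ∧ ∀ g : Cp X, SelFin (GammaAt g) (OmegaAt g),
      SeqSeparable (Cp X) ∧ ∀ g : Cp X, SelFin (SeqDenseSets (Cp X)) (OmegaAt g)] := by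
  have : Nonempty (Cp X) := ⟨⟨fun _ => 0, continuous_const⟩⟩
  tfae_have 1 → 4 := fun h => ⟨h.1, fun g =>
    have := Cp.nhdsNE_neBot g
    selFin_omegaAt_of_selFin_dense h.2⟩
  tfae_have 4 → 1 := fun h => ⟨h.1, selFin_seqDense_dense_of_omegaAt h.1 h.2⟩
  tfae_have 4 → 2 := fun h => ⟨selFin_covers_of_seqDense h.1 h.2, h.1.propertyV⟩
  tfae_have 2 → 3 := fun h => ⟨h.2.seqSeparable, selFin_gammaAt_omegaAt_of_covers h.1⟩
  tfae_have 3 → 4 := fun h => ⟨h.1, fun g => selFin_seqDense_omegaAt_of_gammaAt (h.2 g)⟩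
  tfae_finish
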